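/- Let $\mathbb{F}_q$ be a finite field with $q$ elements, let $A=\mathbb{F}_q[t]$, and let $K$ be a finite field extension of $\mathbb{F}_q(t)$. Let $K\{\tau\}$ be the ring of polynomials $\sum_n c_n\tau^n$ with coefficients in $K$, where $\tau$ is the Frobenius $x\mapsto x^q$, addition is the usual one and multiplication is composition (so $\tau c=c^q\tau$ for $c\in K$); the element $f=\sum_n c_n\tau^n$ acts on $\mathbb{G}_a(K)=K$ by $f(x)=\sum_n c_n x^{q^n}$. A Drinfeld module over $K$ (of generic characteristic) is a ring homomorphism $\phi\colon A\to K\{\tau\}$, $a\mapsto\phi_a$, such that for every $a\in A$ the coefficient of $\tau^0$ in $\phi_a$ is $a$, and such that $\phi_a\neq a\tau^0$ for some $a\in A$. Let $\phi_1,\dots,\phi_g$ be Drinfeld modules over $K$. Then $A$ acts on $\mathbb{G}_a^g(K)=K^g$ by $a*(y_1,\dots,y_g)=((\phi_1)_a(y_1),\dots,(\phi_g)_a(y_g))$, and a $(\phi_1,\dots,\phi_g)$-submodule is a subgroup of $\mathbb{G}_a^g(K)$ that is invariant under this action. Let $(x_1,\dots,x_g)\in\mathbb{G}_a^g(K)$,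 let $\Gamma\subset\mathbb{G}_a^g(K)$ be the cyclic $(\phi_1,\dots,\phi_g)$-submodule generated by $(x_1,\dots,x_g)$, that is, the smallest submodule containing this point, and let $V\subset\mathbb{G}_a^g$ be a closed (not necessarily irreducible) affine subvariety defined over $K$. Then $V(K)\cap\Gamma$ is a finite (possibly empty) union of cosets $\gamma+N$, where $\gamma\in\Gamma$ and $N\subset\Gamma$ is a $(\phi_1,\dots,\phi_g)$-submodule. -/

import Mathlib

open scoped Polynomial

noncomputable section

/-- The action of `ℕ` on `K` by iterating the `q`-power Frobenius `x ↦ x ^ q`, where `q = #F`.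
It is not registered as an instance, since it depends on `F`. -/
abbrev frobeniusAction (F K : Type*) [Field F] [Fintype F] [Field K] [Algebra F K] :
    MulSemiringAction (Multiplicative ℕ) K :=
  MulSemiringAction.compHom K
    (powersHom (K →+* K) (FiniteField.frobeniusAlgHom F K : K →+* K))

/-- The ring `K{τ}` of polynomials in the `q`-power Frobenius `τ` with coefficients in `K`:
the skew polynomials over `K`, with the multiplication determined by `τ c = c ^ q τ`
(composition of functions). -/
@[nolint unusedArguments]
def TwistedPolynomial (F K : Type*) [Field F] [Fintype F] [Field K] [Algebra F K] : Type _ :=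
  SkewPolynomial K

namespace TwistedPolynomial

variable {F K : Type*} [Field F] [Fintype F] [Field K] [Algebra F K]

instance instRing : Ring (TwistedPolynomial F K) :=
  letI := frobeniusAction F K
  inferInstanceAs (Ring (SkewPolynomial K))

/-- The coefficient of `τ ^ n`. -/
def coeff (f : TwistedPolynomial F K) (n : ℕ) : K := SkewPolynomial.coeff f n

variable (F) in
/-- The constant twisted polynomial `c τ ^ 0`. -/
def const (c : K) : TwistedPolynomial F K := SkewPolynomial.C c

/-- The function on `𝔾ₐ(K) = K` given by a twisted polynomial:
`∑ cₙ τ ^ n` sends `x` to `∑ cₙ x ^ (q ^ n)`. -/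
def eval (f : TwistedPolynomial F K) (x : K) : K :=
  SkewPolynomial.sum f fun n c => c * x ^ Fintype.card F ^ n

end TwistedPolynomial

/-- A Drinfeld module over `K` (of generic characteristic) for `A = F[t]`: a ring homomorphism
`a ↦ φ_a` from `A` to `K{τ}` such that the coefficient of `τ ^ 0` in `φ_a` is `a` for all `a`,
and such that `φ_a ≠ a τ ^ 0` for some `a`. -/
structure DrinfeldModule (F K : Type*) [Field F] [Fintype F] [Field K] [Algebra F K]
    [Algebra F[X] K] where
  /-- The ring homomorphism `a ↦ φ_a`. -/
  toRingHom : F[X] →+* TwistedPolynomial F K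
  coeff_zero : ∀ a : F[X], (toRingHom a).coeff 0 = algebraMap F[X] K a
  exists_ne_const : ∃ a : F[X], toRingHom a ≠ TwistedPolynomial.const F (algebraMap F[X] K a)

namespace DrinfeldModule

variable {F K : Type*} [Field F] [Fintype F] [Field K] [Algebra F K] [Algebra F[X] K] {g : ℕ}

/-- The coordinatewise action of `(φ₁, …, φ_g)` on `𝔾ₐ^g(K) = K ^ g`. -/
def act (φ : Fin g → DrinfeldModule F K) (a : F[X]) (x : Fin g → K) : Fin g → K :=
  fun i => ((φ i).toRingHom a).eval (x i)

/-- A subgroup of `𝔾ₐ^g(K)` is a `(φ₁, …, φ_g)`-submodule if it is invariant under the action. -/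
def IsSubmodule (φ : Fin g → DrinfeldModule F K) (H : AddSubgroup (Fin g → K)) : Prop :=
  ∀ a : F[X], ∀ x ∈ H, act φ a x ∈ H

/-- The cyclic `(φ₁, …, φ_g)`-submodule of `𝔾ₐ^g(K)` generated by the point `x`: the smallest
submodule that contains `x`. -/
def cyclicSubmodule (φ : Fin g → DrinfeldModule F K) (x : Fin g → K) :
    AddSubgroup (Fin g → K) :=
  sInf {H | IsSubmodule φ H ∧ x ∈ H}

end DrinfeldModule

end

/-! The proof is a positive-characteristic analogue of the method of Skolem and Chabauty. A real
valuation of `K` is chosen with `t`, the coordinates of `x` and all coefficients of the `(φ i)_t`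
integral, dominating a maximal ideal with finite residue field (`exists_valuation_dominating`).

Since `φ_a` commutes with `φ_t`, its coefficient of `τ ^ k` is a polynomial `c_k` evaluated at `a`
(`eval_coeffPoly`). If `0 < δ ≤ 1` and `δ ≤ |t ^ q ^ k - t|` for all `k ≥ 1`, the Gauss norm of
`c_k` is at most `δ⁻¹ ^ (q ^ k - 1)` (`gaussLE_coeffPoly`). So for `|y| < δ` the series `∑ c_k(a) y
^ q ^ k` makes `a ↦ φ_a(y)` an analytic function of `a` on the unit disc, and so is any polynomial
in such functions. By Strassmann's theorem it vanishes at every `a ∈ A` or at only finitely many. To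
avoid completing `K`, analytic functions are replaced by sequences of polynomials that are Cauchy
for the Gauss norm.

A nonzero `M ∈ A` moves `x` into this small disc. As `A / M` is finite, `Γ` is a finite union of
cosets of `A * (M * x)`, and each of them lies in `V` or meets it in a finite set. -/

open scoped NNReal
open Filter Topology

noncomputable section

/-! ### Multiplication and evaluation of twisted polynomials -/

namespace TwistedPolynomial

variable {F K : Type*} [Field F] [Fintype F] [Field K] [Algebra F K]

theorem pow_card_add (F : Type*) {K : Type*} [Field F] [Fintype F] [Field K] [Algebra F K]
    (a b : K) (i : ℕ) :
    (a + b) ^ Fintype.card F ^ i = a ^ Fintype.card F ^ i + b ^ Fintype.card F ^ i := by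
  obtain ⟨p, hp⟩ := CharP.exists F
  have : CharP K p := charP_of_injective_algebraMap (algebraMap F K).injective p
  obtain ⟨e, hpp, he⟩ := FiniteField.card F p
  have : Fact p.Prime := ⟨hpp⟩
  rw [he, ← pow_mul, add_pow_char_pow]

theorem pow_card_sub (F : Type*) {K : Type*} [Field F] [Fintype F] [Field K] [Algebra F K]
    (a b : K) (i : ℕ) :
    (a - b) ^ Fintype.card F ^ i = a ^ Fintype.card F ^ i - b ^ Fintype.card F ^ i := by
  rw [eq_sub_iff_add_eq, ← pow_card_add, sub_add_cancel]

@[ext] theorem ext {f g : TwistedPolynomial F K} (h : ∀ n, f.coeff n = g.coeff n) : f = g :=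
  SkewMonoidAlgebra.ext fun n => h n.toAdd

@[simp] theorem coeff_add (f g : TwistedPolynomial F K) (n : ℕ) :
    (f + g).coeff n = f.coeff n + g.coeff n :=
  congrArg (fun h => h (Multiplicative.ofAdd n)) (SkewMonoidAlgebra.coeff_add (k := K) f g)

@[simp] theorem coeff_zero' (n : ℕ) : (0 : TwistedPolynomial F K).coeff n = 0 := rfl

/-- The monomial `c τ ^ n`. -/
def monomial (n : ℕ) (c : K) : TwistedPolynomial F K := SkewPolynomial.monomial n c

theorem coeff_monomial (m n : ℕ) (c : K) :
    (monomial m c : TwistedPolynomial F K).coeff n = if m = n then c else 0 :=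
  SkewPolynomial.coeff_monomial

theorem const_eq_monomial (c : K) : const F c = monomial 0 c := rfl

theorem one_eq_monomial : (1 : TwistedPolynomial F K) = monomial 0 1 := rfl

theorem monomial_mul_monomial (m n : ℕ) (a b : K) :
    (monomial m a * monomial n b : TwistedPolynomial F K) =
      monomial (m + n) (a * b ^ Fintype.card F ^ m) := by
  let := frobeniusAction F K
  have h : ∀ (m : ℕ) (b : K), (SkewPolynomial.φ (R := K))^[m] b = b ^ Fintype.card F ^ m := by
    intro m b
    induction m with
    | zero => simp
    | succ m ih =>
      rw [Function.iterate_succ_apply', ih]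
      have : ∀ c : K, (SkewPolynomial.φ (R := K)) c = c ^ Fintype.card F := by
        intro c
        change (powersHom (K →+* K) (FiniteField.frobeniusAlgHom F K : K →+* K)
          (Multiplicative.ofAdd 1)) c = _
        simp
      rw [this, ← pow_mul, pow_succ]
  rw [← h]
  exact SkewPolynomial.monomial_mul_monomial m n a b

theorem induction_on {P : TwistedPolynomial F K → Prop} (f : TwistedPolynomial F K)
    (h0 : P 0) (hm : ∀ n c, P (monomial n c)) (ha : ∀ f g, P f → P g → P (f + g)) : P f :=
  SkewPolynomial.induction (motive := P) f h0 fun n r _ _ _ hq => ha _ _ (hm n r) hq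

theorem coeff_mul (f g : TwistedPolynomial F K) (n : ℕ) :
    (f * g).coeff n =
      ∑ p ∈ Finset.HasAntidiagonal.antidiagonal n,
        f.coeff p.1 * g.coeff p.2 ^ Fintype.card F ^ p.1 := by
  have hq (i : ℕ) : Fintype.card F ^ i ≠ 0 := (pow_pos Fintype.card_pos i).ne'
  induction f using induction_on with
  | h0 => simp
  | ha f₁ f₂ h₁ h₂ => simp [add_mul, h₁, h₂, Finset.sum_add_distrib]
  | hm i a =>
    induction g using induction_on with
    | h0 => simp [zero_pow (hq _)]
    | ha g₁ g₂ h₁ h₂ => simp [mul_add, h₁, h₂, pow_card_add F, Finset.sum_add_distrib]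
    | hm j b =>
      rw [monomial_mul_monomial, coeff_monomial]
      split_ifs with h
      · subst h
        rw [Finset.sum_eq_single (i, j)]
        · simp [coeff_monomial]
        · rintro ⟨k, l⟩ hkl hne
          simp only [coeff_monomial]
          split_ifs with h1 h2 <;> simp_all
        · simp
      · symm
        apply Finset.sum_eq_zero
        rintro ⟨k, l⟩ hkl
        simp only [coeff_monomial]
        split_ifs with h1 h2
        · subst h1 h2; simp_all
        · simp [zero_pow (hq _)]
        · simp
        · simp

theorem eval_monomial (n : ℕ) (c x : K) :
    (monomial n c : TwistedPolynomial F K).eval x = c * x ^ Fintype.card F ^ n :=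
  SkewPolynomial.sum_monomial_index (by simp)

@[simp] theorem eval_zero (x : K) : (0 : TwistedPolynomial F K).eval x = 0 := rfl

@[simp] theorem eval_add (f g : TwistedPolynomial F K) (x : K) :
    (f + g).eval x = f.eval x + g.eval x :=
  SkewMonoidAlgebra.sum_add_index' (by simp) (by simp [add_mul])

@[simp] theorem eval_one (x : K) : (1 : TwistedPolynomial F K).eval x = x := by
  rw [one_eq_monomial, eval_monomial]; simp

theorem eval_add_right (f : TwistedPolynomial F K) (x y : K) :
    f.eval (x + y) = f.eval x + f.eval y := by
  induction f using induction_on with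
  | h0 => simp
  | ha f₁ f₂ h₁ h₂ => simp only [eval_add, h₁, h₂]; ring
  | hm i a => simp only [eval_monomial, pow_card_add F, mul_add]

@[simp] theorem eval_zero_right (f : TwistedPolynomial F K) : f.eval 0 = 0 := by
  simpa using eval_add_right f 0 0

theorem eval_mul (f g : TwistedPolynomial F K) (x : K) :
    (f * g).eval x = f.eval (g.eval x) := by
  induction f using induction_on with
  | h0 => simp
  | ha f₁ f₂ h₁ h₂ => simp [add_mul, h₁, h₂]
  | hm i a =>
    induction g using induction_on with
    | h0 => simp
    | ha g₁ g₂ h₁ h₂ => rw [mul_add, eval_add, h₁, h₂, eval_add, eval_add_right]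
    | hm j b =>
      rw [monomial_mul_monomial, eval_monomial, eval_monomial, eval_monomial, mul_pow, ← pow_mul,
        ← pow_add, add_comm j, mul_assoc]

theorem exists_eval_eq_sum_range (f : TwistedPolynomial F K) :
    ∃ N, ∀ n, N ≤ n →
      ∀ x, f.eval x = ∑ k ∈ Finset.range n, f.coeff k * x ^ Fintype.card F ^ k := by
  induction f using induction_on with
  | h0 => exact ⟨0, by simp⟩
  | ha f g hf hg =>
    obtain ⟨N, hN⟩ := hf
    obtain ⟨M, hM⟩ := hg
    refine ⟨max N M, fun n hn x => ?_⟩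
    rw [eval_add, hN n (le_of_max_le_left hn), hM n (le_of_max_le_right hn),
      ← Finset.sum_add_distrib]
    simp [add_mul]
  | hm i a =>
    refine ⟨i + 1, fun n hn x => ?_⟩
    simp only [eval_monomial, coeff_monomial, ite_mul, zero_mul]
    rw [Finset.sum_ite_eq, if_pos (Finset.mem_range.mpr hn)]

end TwistedPolynomial

/-- All coefficients of `p` have valuation at most `r`, i.e. the Gauss norm of `p` is at most
`r`. -/
def GaussLE {K : Type*} [Field K] (v : Valuation K ℝ≥0) (p : K[X]) (r : ℝ≥0) : Prop :=
  ∀ n, v (p.coeff n) ≤ r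

/-! ### Bounds for the Gauss norm -/

namespace GaussLE

variable {K : Type*} [Field K] {v : Valuation K ℝ≥0} {p p' : K[X]} {r r' : ℝ≥0}

theorem mono (h : GaussLE v p r) (hr : r ≤ r') : GaussLE v p r' := fun n => (h n).trans hr

theorem add (h : GaussLE v p r) (h' : GaussLE v p' r) : GaussLE v (p + p') r := fun n => by
  rw [Polynomial.coeff_add]
  exact v.map_add_le (h n) (h' n)

theorem neg (h : GaussLE v p r) : GaussLE v (-p) r := fun n => by
  rw [Polynomial.coeff_neg, Valuation.map_neg]
  exact h n

theorem sub (h : GaussLE v p r) (h' : GaussLE v p' r) : GaussLE v (p - p') r :=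
  sub_eq_add_neg p p' ▸ h.add h'.neg

theorem zero : GaussLE v 0 r := fun n => by simp

theorem sum {ι : Type*} (s : Finset ι) {f : ι → K[X]} (h : ∀ i ∈ s, GaussLE v (f i) r) :
    GaussLE v (∑ i ∈ s, f i) r :=
  Finset.sum_induction f (fun p => GaussLE v p r) (fun _ _ => add) zero h

theorem mul (h : GaussLE v p r) (h' : GaussLE v p' r') : GaussLE v (p * p') (r * r') := fun n => by
  rw [Polynomial.coeff_mul]
  refine v.map_sum_le fun x _ => ?_
  rw [map_mul]
  exact mul_le_mul' (h _) (h' _)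

theorem C {c : K} (h : v c ≤ r) : GaussLE v (Polynomial.C c) r := fun n => by
  rw [Polynomial.coeff_C]
  split_ifs
  · exact h
  · simp

theorem one : GaussLE v (1 : K[X]) 1 := GaussLE.C (c := 1) (by simp)

theorem X : GaussLE v (Polynomial.X : K[X]) 1 := fun n => by
  rw [Polynomial.coeff_X]
  split_ifs <;> simp

theorem pow (h : GaussLE v p r) (n : ℕ) : GaussLE v (p ^ n) (r ^ n) := by
  induction n with
  | zero => simpa using one
  | succ n ih => simpa only [pow_succ] using ih.mul h

theorem eval (h : GaussLE v p r) {a : K} (ha : v a ≤ 1) : v (p.eval a) ≤ r := by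
  rw [Polynomial.eval_eq_sum_range]
  refine v.map_sum_le fun i _ => ?_
  rw [map_mul, map_pow]
  exact (mul_le_of_le_one_right' (pow_le_one' ha i)).trans (h i)

end GaussLE

/-! ### Coefficients of commuting twisted polynomials -/

namespace TwistedPolynomial

variable {F K : Type*} [Field F] [Fintype F] [Field K] [Algebra F K]

/-- Compare the coefficients of `τ ^ (k + 1)` in `f * g = g * f` and isolate the two terms that
contain `f.coeff (k + 1)`. -/
theorem coeff_recursion {f g : TwistedPolynomial F K} (h : Commute f g) (k : ℕ) :
    (g.coeff 0 ^ Fintype.card F ^ (k + 1) - g.coeff 0) * f.coeff (k + 1) =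
      ∑ i ∈ Finset.range (k + 1),
        (g.coeff (k + 1 - i) * f.coeff i ^ Fintype.card F ^ (k + 1 - i) -
          g.coeff (k + 1 - i) ^ Fintype.card F ^ i * f.coeff i) := by
  have h₁ := congrArg (fun f => f.coeff (k + 1)) h.eq
  simp only [coeff_mul] at h₁
  rw [← Finset.Nat.sum_antidiagonal_swap (n := k + 1)
      (f := fun p : ℕ × ℕ => g.coeff p.1 * f.coeff p.2 ^ Fintype.card F ^ p.1),
    Finset.Nat.sum_antidiagonal_eq_sum_range_succ_mk,
    Finset.Nat.sum_antidiagonal_eq_sum_range_succ_mk,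
    Finset.sum_range_succ _ (k + 1), Finset.sum_range_succ _ (k + 1)] at h₁
  simp only [Prod.swap, Nat.sub_self, pow_zero, pow_one] at h₁
  rw [Finset.sum_sub_distrib, sub_mul, sub_eq_sub_iff_add_eq_add, add_comm (_ * _) (∑ _ ∈ _, _),
    add_comm (∑ _ ∈ _, _) (g.coeff 0 * _)]
  rw [add_comm (∑ _ ∈ _, _) (g.coeff 0 * _)] at h₁
  rw [← h₁]
  congr 1
  · exact Finset.sum_congr rfl fun i _ => mul_comm _ _
  · exact mul_comm _ _

variable (F) in
/-- The polynomials `c_k` over `K` such that the coefficients of a twisted polynomial that commutes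
with `b₀ + b₁ τ + ⋯` and has constant coefficient `a` are `c_k(a)`. -/
def coeffPoly (b : ℕ → K) : ℕ → K[X]
  | 0 => Polynomial.X
  | k + 1 => Polynomial.C (b 0 ^ Fintype.card F ^ (k + 1) - b 0)⁻¹ *
      ∑ i : Fin (k + 1),
        (Polynomial.C (b (k + 1 - i)) * coeffPoly b i ^ Fintype.card F ^ (k + 1 - i : ℕ) -
          Polynomial.C (b (k + 1 - i) ^ Fintype.card F ^ (i : ℕ)) * coeffPoly b i)
  decreasing_by all_goals exact i.2

theorem eval_coeffPoly {f g : TwistedPolynomial F K} (h : Commute f g)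
    (hg : ∀ k, g.coeff 0 ^ Fintype.card F ^ (k + 1) ≠ g.coeff 0) (k : ℕ) :
    (coeffPoly F g.coeff k).eval (f.coeff 0) = f.coeff k := by
  induction k using Nat.strong_induction_on with
  | _ k ih =>
    cases k with
    | zero => simp [coeffPoly]
    | succ k =>
      rw [coeffPoly, Polynomial.eval_mul, Polynomial.eval_C,
        inv_mul_eq_iff_eq_mul₀ (sub_ne_zero.mpr (hg k)), coeff_recursion h, Finset.sum_range,
        Polynomial.eval_finsetSum]
      refine Finset.sum_congr rfl fun i _ => ?_
      simp [ih i i.2]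

omit [Algebra F K] in
theorem gaussLE_coeffPoly {v : Valuation K ℝ≥0} {b : ℕ → K} (hb : ∀ k, v (b k) ≤ 1) {δ : ℝ≥0}
    (h0 : 0 < δ) (h1 : δ ≤ 1) (hδ : ∀ k, δ ≤ v (b 0 ^ Fintype.card F ^ (k + 1) - b 0)) (k : ℕ) :
    GaussLE v (coeffPoly F b k) (δ⁻¹ ^ (Fintype.card F ^ k - 1)) := by
  have hR : 1 ≤ δ⁻¹ := one_le_inv₀ h0 |>.mpr h1
  have hq : 2 ≤ Fintype.card F := Fintype.one_lt_card
  induction k using Nat.strong_induction_on with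
  | _ k ih =>
    cases k with
    | zero => simpa [coeffPoly] using GaussLE.X (v := v)
    | succ k =>
      have hk : 2 ≤ Fintype.card F ^ (k + 1) := hq.trans (Nat.le_self_pow (by simp) _)
      rw [coeffPoly, show Fintype.card F ^ (k + 1) - 1 = 1 + (Fintype.card F ^ (k + 1) - 2) by lia,
        pow_add δ⁻¹ 1, pow_one]
      refine GaussLE.mul (GaussLE.C (K := K) ?_) (GaussLE.sum _ fun i _ => GaussLE.sub ?_ ?_)
      · rw [map_inv₀]
        exact inv_anti₀ h0 (hδ k)
      · have h := (GaussLE.C (v := v) (hb (k + 1 - i))).mul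
          ((ih i i.2).pow (Fintype.card F ^ (k + 1 - i : ℕ)))
        rw [one_mul, ← pow_mul] at h
        refine h.mono (pow_le_pow_right₀ hR ?_)
        have hi : i ≤ k := Nat.lt_succ_iff.mp i.2
        -- With `j = k + 1 - i ≥ 1`, the exponent is `q ^ j * (q ^ i - 1) = q ^ (k + 1) - q ^ j`. As
        -- `q ^ j ≥ 2`, there is room for the one factor `δ⁻¹` from the division.
        rw [Nat.sub_mul, ← pow_add, one_mul, show (i : ℕ) + (k + 1 - i) = k + 1 by lia]
        have : 2 ≤ Fintype.card F ^ (k + 1 - i : ℕ) := hq.trans (Nat.le_self_pow (by lia) _)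
        lia
      · have h := (GaussLE.C (v := v) (r := 1) (c := b (k + 1 - i) ^ Fintype.card F ^ (i : ℕ))
          (by rw [map_pow]; exact pow_le_one' (hb _) _)).mul (ih i i.2)
        rw [one_mul] at h
        refine h.mono (pow_le_pow_right₀ hR ?_)
        have : Fintype.card F ^ (i : ℕ) < Fintype.card F ^ (k + 1) :=
          Nat.pow_lt_pow_right hq i.2
        lia

theorem eq_of_commute {f f' g : TwistedPolynomial F K} (h : Commute f g) (h' : Commute f' g)
    (hg : ∀ k, g.coeff 0 ^ Fintype.card F ^ (k + 1) ≠ g.coeff 0)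
    (h0 : f.coeff 0 = f'.coeff 0) : f = f' := by
  ext k
  rw [← eval_coeffPoly h hg, ← eval_coeffPoly h' hg, h0]

theorem commute_const (c : F) (f : TwistedPolynomial F K) :
    Commute (const F (algebraMap F K c)) f := by
  induction f using induction_on with
  | h0 => exact Commute.zero_right _
  | ha f g hf hg => exact hf.add_right hg
  | hm n a =>
    have : algebraMap F K c ^ Fintype.card F ^ n = algebraMap F K c := by
      rw [← map_pow, FiniteField.pow_card_pow]
    rw [Commute, SemiconjBy, const_eq_monomial, monomial_mul_monomial, monomial_mul_monomial, this]
    simp [mul_comm]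

end TwistedPolynomial

/-! ### Strassmann's theorem for sequences of polynomials -/

section Strassmann

variable {K : Type*} [Field K] {v : Valuation K ℝ≥0}

/-- The coefficient of index `j` of the quotient is a combination, with powers of `a` as weights, of
the coefficients of `p` of index greater than `j`. Hence division lowers the threshold by one. -/
theorem valuation_coeff_divByMonic_le {p : K[X]} {a : K} (ha : v a ≤ 1) {ε : ℝ≥0} {d : ℕ}
    (h : ∀ j, d + 1 ≤ j → v (p.coeff j) ≤ ε) (j : ℕ) (hj : d ≤ j) :
    v ((p /ₘ (Polynomial.X - Polynomial.C a)).coeff j) ≤ ε := by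
  rw [Polynomial.coeff_divByMonic_X_sub_C]
  refine v.map_sum_le fun i hi => ?_
  rw [map_mul, map_pow]
  refine (mul_le_of_le_one_left' (pow_le_one' ha _)).trans (h i ?_)
  have := (Finset.mem_Icc.mp hi).1
  lia

/-- A quantitative form of Strassmann's theorem for sequences of polynomials: if the polynomials
`H n` tend to `0` at `d` integral points and their coefficients of index at least `d` are at most
`ε`, then so are all their coefficients, eventually. -/
theorem eventually_gaussLE_of_tendsto_zero {ε : ℝ≥0} (hε : 0 < ε) (d : ℕ) :
    ∀ (H : ℕ → K[X]) (s : Finset K), s.card = d → (∀ a ∈ s, v a ≤ 1) →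
      (∀ a ∈ s, Tendsto (fun n => v ((H n).eval a)) atTop (𝓝 0)) →
      (∀ᶠ n in atTop, ∀ j, d ≤ j → v ((H n).coeff j) ≤ ε) →
      ∀ᶠ n in atTop, GaussLE v (H n) ε := by
  classical
  induction d with
  | zero =>
    intro H s _ _ _ h
    filter_upwards [h] with n hn j using hn j (Nat.zero_le j)
  | succ d ih =>
    intro H s hs hs1 hs0 h
    obtain ⟨a, ha⟩ : s.Nonempty := by
      rw [← Finset.card_pos, hs]
      exact Nat.succ_pos d
    have hdiv (n : ℕ) : H n = (Polynomial.X - Polynomial.C a) *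
        (H n /ₘ (Polynomial.X - Polynomial.C a)) + Polynomial.C ((H n).eval a) := by
      conv_lhs => rw [← Polynomial.modByMonic_add_div (H n) (Polynomial.X - Polynomial.C a)]
      rw [Polynomial.modByMonic_X_sub_C_eq_C_eval, add_comm]
    have hsmall := (hs0 a ha).eventually (Iic_mem_nhds hε)
    -- Induction on the number of points: the quotients by `X - a` tend to `0` at each remaining
    -- point `b`, their value there being `(H(b) - H(a)) / (b - a)`.
    have hQ := ih (fun n => H n /ₘ (Polynomial.X - Polynomial.C a)) (s.erase a)
      (by rw [Finset.card_erase_of_mem ha, hs]; rfl)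
      (fun b hb => hs1 b (Finset.mem_of_mem_erase hb)) ?_ ?_
    · filter_upwards [hQ, hsmall] with n hn hn'
      rw [hdiv n]
      refine GaussLE.add ?_ (GaussLE.C hn')
      have := (GaussLE.X.sub (GaussLE.C (hs1 a ha))).mul hn
      rwa [one_mul] at this
    · intro b hb
      have hba : b - a ≠ 0 := sub_ne_zero.mpr (Finset.ne_of_mem_erase hb)
      have hval (n : ℕ) : (H n /ₘ (Polynomial.X - Polynomial.C a)).eval b =
          (b - a)⁻¹ * ((H n).eval b - (H n).eval a) := by
        conv_rhs => rw [hdiv n]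
        simp [hba]
      have hmax : Tendsto (fun n => (v (b - a))⁻¹ * max (v ((H n).eval b)) (v ((H n).eval a)))
          atTop (𝓝 0) := by
        simpa using ((hs0 b (Finset.mem_of_mem_erase hb)).max (hs0 a ha)).const_mul (v (b - a))⁻¹
      refine tendsto_of_tendsto_of_tendsto_of_le_of_le tendsto_const_nhds hmax
        (fun _ => zero_le) fun n => ?_
      simp only [hval, map_mul, map_inv₀]
      gcongr
      exact v.map_sub _ _
    · filter_upwards [h] with n hn j hj
      exact valuation_coeff_divByMonic_le (hs1 a ha) hn j hj

/-- The sequence of polynomials `H` is Cauchy for the Gauss norm. -/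
def IsGaussCauchy (v : Valuation K ℝ≥0) (H : ℕ → K[X]) : Prop :=
  ∀ ε : ℝ≥0, 0 < ε → ∀ᶠ n in atTop, GaussLE v (H (n + 1) - H n) ε

/-- Strassmann's theorem: a Cauchy sequence of polynomials that tends to `0` at infinitely many
integral points tends to `0` for the Gauss norm. -/
theorem IsGaussCauchy.eventually_gaussLE {H : ℕ → K[X]} (hH : IsGaussCauchy v H)
    (hinf : {a : K | v a ≤ 1 ∧ Tendsto (fun n => v ((H n).eval a)) atTop (𝓝 0)}.Infinite)
    {ε : ℝ≥0} (hε : 0 < ε) : ∀ᶠ n in atTop, GaussLE v (H n) ε := by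
  obtain ⟨N, hN⟩ := eventually_atTop.mp (hH ε hε)
  have hdiff (n : ℕ) (hn : N ≤ n) : GaussLE v (H n - H N) ε := by
    induction n, hn using Nat.le_induction with
    | base => simpa using GaussLE.zero
    | succ n hn ih => simpa using (hN n hn).add ih
  -- From `N` on, every coefficient beyond the degree of `H N` is at most `ε`, so `natDegree + 1`
  -- points suffice.
  obtain ⟨s, hs, hcard⟩ := hinf.exists_subset_card_eq ((H N).natDegree + 1)
  refine eventually_gaussLE_of_tendsto_zero hε _ H s hcard (fun a ha => (hs ha).1)
    (fun a ha => (hs ha).2) (eventually_atTop.mpr ⟨N, fun n hn j hj => ?_⟩)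
  have := hdiff n hn j
  rwa [Polynomial.coeff_sub, Polynomial.coeff_eq_zero_of_natDegree_lt hj, sub_zero] at this

/-- The bounded Cauchy sequences of polynomials. -/
def gaussCauchySubalgebra (v : Valuation K ℝ≥0) : Subalgebra K (ℕ → K[X]) where
  carrier := {H | IsGaussCauchy v H ∧ ∃ r, ∀ n, GaussLE v (H n) r}
  add_mem' := by
    rintro G H ⟨hG, r, hr⟩ ⟨hH, s, hs⟩
    refine ⟨fun ε hε => ?_, max r s, fun n =>
      ((hr n).mono (le_max_left r s)).add ((hs n).mono (le_max_right r s))⟩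
    filter_upwards [hG ε hε, hH ε hε] with n h₁ h₂
    simpa [add_sub_add_comm] using h₁.add h₂
  mul_mem' := by
    rintro G H ⟨hG, r, hr⟩ ⟨hH, s, hs⟩
    refine ⟨fun ε hε => ?_, r * s, fun n => (hr n).mul (hs n)⟩
    -- The bounds `r` and `s` may be `0`; adding `1` keeps both tolerances positive.
    filter_upwards [hG (ε / (s + 1)) (by positivity), hH (ε / (r + 1)) (by positivity)] with n h₁ h₂
    have e : (G * H) (n + 1) - (G * H) n =
        (G (n + 1) - G n) * H (n + 1) + G n * (H (n + 1) - H n) := by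
      simp only [Pi.mul_apply]; ring
    rw [e]
    refine ((h₁.mul (hs _)).mono ?_).add (((hr _).mul h₂).mono ?_)
    · rw [div_mul_eq_mul_div]
      exact div_le_of_le_mul₀ (by positivity) (by positivity) (by gcongr; simp)
    · rw [mul_div_assoc', mul_comm]
      exact div_le_of_le_mul₀ (by positivity) (by positivity) (by gcongr; simp)
  algebraMap_mem' c := by
    refine ⟨fun ε _ => ?_, v c, fun n => GaussLE.C le_rfl⟩
    exact Eventually.of_forall fun n => by simpa using GaussLE.zero (v := v)

end Strassmann

/-! ### Real valuations on function fields -/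

namespace Valuation

variable {F K : Type*} [Field F] [Finite F] [Field K] [Algebra F K]
  {Γ₀ : Type*} [LinearOrderedCommGroupWithZero Γ₀] (v : Valuation K Γ₀)

theorem algebraMap_eq_one_of_finite {c : F} (hc : c ≠ 0) : v (algebraMap F K c) = 1 := by
  have := Fintype.ofFinite F
  have h : v (algebraMap F K c) ^ (Fintype.card F - 1) = 1 := by
    rw [← map_pow, ← map_pow, FiniteField.pow_card_sub_one_eq_one c hc, map_one, map_one]
  exact (pow_eq_one_iff_of_nonneg zero_le (Nat.sub_ne_zero_of_lt Fintype.one_lt_card)).mp h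

theorem algebraMap_le_one_of_finite (c : F) : v (algebraMap F K c) ≤ 1 := by
  obtain rfl | hc := eq_or_ne c 0
  · simp
  · exact (v.algebraMap_eq_one_of_finite hc).le

variable (F) in
/-- The valuation ring of `v` as a subalgebra over a finite field. -/
def integerSubalgebra : Subalgebra F K :=
  { v.integer with algebraMap_mem' := v.algebraMap_le_one_of_finite }

theorem aeval_le_one_of_finite {s : K} (hs : v s ≤ 1) (P : F[X]) : v (Polynomial.aeval s P) ≤ 1 :=
  Algebra.adjoin_le (S := v.integerSubalgebra F) (Set.singleton_subset_iff.mpr hs)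
    (Polynomial.aeval_mem_adjoin_singleton F s)

theorem aeval_eq_one_of_finite {s : K} (hs : v s < 1) {P : F[X]} (hP : P.coeff 0 ≠ 0) :
    v (Polynomial.aeval s P) = 1 := by
  rw [← Polynomial.divX_mul_X_add P, map_add, map_mul, Polynomial.aeval_X, Polynomial.aeval_C,
    Valuation.map_add_eq_of_lt_right, v.algebraMap_eq_one_of_finite hP]
  rw [v.algebraMap_eq_one_of_finite hP, map_mul]
  exact (mul_le_of_le_one_left' (v.aeval_le_one_of_finite hs.le _)).trans_lt hs

theorem transcendental_of_lt_one {s : K} (h0 : s ≠ 0) (hs : v s < 1) : Transcendental F s := by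
  intro h
  obtain ⟨P, hP, hPs⟩ :=
    h.exists_nonzero_coeff_and_aeval_eq_zero (mem_nonZeroDivisors_of_ne_zero h0)
  have := v.aeval_eq_one_of_finite hs hP
  simp [hPs] at this

/-- If `|u| ≤ 1`, an algebraic relation gives `u * w = P(s) ≠ 0` with `w` integral. Writing `P = X ^
n * Q` with `Q(0) ≠ 0` yields `|s| ^ n = |P(s)| ≤ |u|`. -/
theorem exists_pow_le_of_isAlgebraic {s u : K} (hs : v s < 1) (hu0 : u ≠ 0)
    (hu : IsAlgebraic (Algebra.adjoin F {s}) u) : ∃ n : ℕ, v s ^ n ≤ v u := by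
  obtain hu1 | hu1 := le_total 1 (v u)
  · exact ⟨0, by simpa using hu1⟩
  obtain ⟨w, hw, ⟨r, hr⟩, hr0, h⟩ :=
    hu.exists_nonzero_eq_adjoin_mul (mem_nonZeroDivisors_of_ne_zero hu0)
  have hint : ∀ z ∈ Algebra.adjoin F {s}, v z ≤ 1 := fun z hz =>
    (Algebra.adjoin_le (S := v.integerSubalgebra F) (Set.singleton_subset_iff.mpr hs.le)) hz
  have hw1 : v w ≤ 1 := by
    clear h
    induction hw using Algebra.adjoin_induction with
    | mem x hx => rwa [Set.mem_singleton_iff.mp hx]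
    | algebraMap z => exact hint z z.2
    | add x y _ _ hx hy => exact v.map_add_le hx hy
    | mul x y _ _ hx hy => rw [map_mul]; exact mul_le_one' hx hy
  rw [Algebra.adjoin_singleton_eq_range_aeval] at hr
  obtain ⟨P, rfl⟩ := hr
  have hP : P ≠ 0 := by
    rintro rfl
    exact hr0 (Subtype.ext (by simp))
  obtain ⟨Q, hPQ, hQ⟩ := Polynomial.exists_eq_pow_rootMultiplicity_mul_and_not_dvd P hP 0
  simp only [Polynomial.C_0, sub_zero, Polynomial.X_dvd_iff] at hPQ hQ
  refine ⟨P.rootMultiplicity 0, ?_⟩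
  have h' : u * w = Polynomial.aeval s P := h
  have h'' := congrArg v h'
  rw [hPQ] at h''
  simp only [map_mul, map_pow, Polynomial.aeval_X, v.aeval_eq_one_of_finite hs hQ, mul_one] at h''
  rw [← h'']
  exact mul_le_of_le_one_right' hw1

/-- The hypothesis says that the value group is archimedean, so it embeds into the positive reals.
-/
theorem exists_isEquiv_nnreal
    (h : ∀ s u : K, v s < 1 → s ≠ 0 → u ≠ 0 → ∃ n : ℕ, v s ^ n ≤ v u) [v.IsNontrivial] :
    ∃ w : Valuation K ℝ≥0, v.IsEquiv w := by
  have harch : MulArchimedean (MonoidWithZeroHom.ValueGroup₀ (.ofClass v)) := by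
    refine ⟨fun x y hy => ?_⟩
    obtain ⟨a, rfl⟩ := MonoidWithZeroHom.ValueGroup₀.restrict₀_surjective _ x
    obtain ⟨b, rfl⟩ := MonoidWithZeroHom.ValueGroup₀.restrict₀_surjective _ y
    simp only [← Valuation.restrict_def] at hy ⊢
    obtain rfl | ha := eq_or_ne a 0
    · exact ⟨0, by simp⟩
    have hb1 : 1 < v b := by
      rwa [← map_one v.restrict, Valuation.restrict_lt_iff, map_one] at hy
    have hb0 : b ≠ 0 := by
      rintro rfl
      simp at hb1
    obtain ⟨n, hn⟩ := h b⁻¹ a⁻¹ (by rw [map_inv₀]; exact inv_lt_one_of_one_lt₀ hb1)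
      (inv_ne_zero hb0) (inv_ne_zero ha)
    refine ⟨n, ?_⟩
    rw [← map_pow, Valuation.restrict_le_iff, map_pow]
    rw [map_inv₀, map_inv₀, inv_pow] at hn
    exact (inv_le_inv₀ (pow_pos (zero_lt_one.trans hb1) n)
      (zero_lt_iff.mpr ((v.ne_zero_iff).mpr ha))).mp hn
  obtain ⟨hv⟩ := Valuation.nonempty_rankOne_iff_mulArchimedean.mpr harch
  refine ⟨v.restrict.map (RankOne.hom v) (RankOne.strictMono v).monotone, fun x y => ?_⟩
  simp [(RankOne.strictMono v).le_iff_le]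

end Valuation

/-- The transcendence degree of `K` over `F` is one, so `s` alone is a transcendence basis. -/
theorem isAlgebraic_adjoin_of_transcendental {F K : Type*} [Field F] [Field K] [Algebra F K]
    [Algebra F[X] K] [IsScalarTower F F[X] K] [FaithfulSMul F[X] K] [Algebra.IsAlgebraic F[X] K]
    {s : K} (hs : Transcendental F s) (u : K) : IsAlgebraic (Algebra.adjoin F {s}) u := by
  have h₁ := (IsTranscendenceBasis.polynomial Unit F).algebraMap_comp (A := K)
  have h₂ : AlgebraicIndependent F (fun _ : Unit => s) :=
    algebraicIndependent_unique_type_iff.mpr hs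
  have h₃ := h₂.isTranscendenceBasis_of_lift_trdeg_le_of_finite
    (by rw [← h₁.lift_cardinalMk_eq_trdeg])
  have := h₃.isAlgebraic
  rw [Set.range_const] at this
  exact Algebra.IsAlgebraic.isAlgebraic u

/-- In a field `K` that is algebraic over `F(t)` with `F` finite, every finite subset is contained
in a finitely generated subalgebra with a maximal ideal of finite index that is dominated by a
real valuation. -/
theorem exists_valuation_dominating {F K : Type*} [Field F] [Finite F] [Field K] [Algebra F K]
    [Algebra F[X] K] [IsScalarTower F F[X] K] [FaithfulSMul F[X] K] [Algebra.IsAlgebraic F[X] K]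
    (S : Set K) (hS : S.Finite) :
    ∃ (R : Subalgebra F K) (m : Ideal R) (v : Valuation K ℝ≥0), S ⊆ R ∧ m.IsMaximal ∧
      Finite (R ⧸ m) ∧ (∀ x ∈ R, v x ≤ 1) ∧ ∀ x ∈ m, v x < 1 := by
  let R := Algebra.adjoin F (insert (algebraMap F[X] K Polynomial.X) S)
  have hR : Algebra.FiniteType F R :=
    R.fg_iff_finiteType.mp (Subalgebra.fg_def.mpr ⟨_, hS.insert _, rfl⟩)
  obtain ⟨m, hm⟩ := Ideal.exists_maximal R
  let := Ideal.Quotient.field m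
  have := finite_of_finite_type_of_isJacobsonRing F (R ⧸ m)
  have hfin : Finite (R ⧸ m) := Module.finite_of_finite F
  have hX : algebraMap F[X] K Polynomial.X ∈ R := Algebra.subset_adjoin (Set.mem_insert _ _)
  have hR' (a : F[X]) : algebraMap F[X] K a ∈ R := by
    have : algebraMap F[X] K a = Polynomial.aeval (algebraMap F[X] K Polynomial.X) a := by
      rw [Polynomial.aeval_algebraMap_apply, Polynomial.aeval_X_left_apply]
    rw [this]
    exact Algebra.adjoin_le (Set.singleton_subset_iff.mpr hX)
      (Polynomial.aeval_mem_adjoin_singleton F _)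
  obtain ⟨B, hRB, hmB⟩ :=
    Ideal.image_subset_nonunits_valuationSubring (A := R.toSubring) m hm.ne_top
  have hmB' (x : R) (hx : x ∈ m) : B.valuation x < 1 :=
    B.mem_nonunits_iff.mp (hmB ⟨x, hx, rfl⟩)
  -- `F[X]` is infinite and `R ⧸ m` finite, so two polynomials agree modulo `m`; their difference is
  -- nonzero of valuation less than `1`.
  have hnontriv : B.valuation.IsNontrivial := by
    have hinj : ¬ Function.Injective
        (fun a : F[X] => Ideal.Quotient.mk m ⟨algebraMap F[X] K a, hR' a⟩) := fun h =>
      not_finite_iff_infinite.mpr inferInstance (Finite.of_injective _ h)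
    simp only [Function.Injective, not_forall] at hinj
    obtain ⟨a, b, hab, hne⟩ := hinj
    refine ⟨algebraMap F[X] K a - algebraMap F[X] K b, ?_, (hmB' _ (Ideal.Quotient.eq.mp hab)).ne⟩
    rw [Valuation.ne_zero_iff, sub_ne_zero]
    exact (FaithfulSMul.algebraMap_injective F[X] K).ne hne
  obtain ⟨w, hw⟩ := B.valuation.exists_isEquiv_nnreal fun s u hs hs0 hu =>
    B.valuation.exists_pow_le_of_isAlgebraic (F := F) hs hu
      (isAlgebraic_adjoin_of_transcendental (B.valuation.transcendental_of_lt_one hs0 hs) u)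
  refine ⟨R, m, w, (Set.subset_insert _ _).trans Algebra.subset_adjoin, hm, hfin, fun x hx => ?_,
    fun x hx => ?_⟩
  · exact hw.le_one_iff_le_one.mp ((B.valuation_le_one_iff x).mpr (hRB hx))
  · exact hw.lt_one_iff_lt_one.mp (hmB' x hx)

/-! ### Integrality and contraction for twisted polynomials -/

namespace TwistedPolynomial

variable {F K : Type*} [Field F] [Fintype F] [Field K] [Algebra F K]

theorem finite_range_coeff (f : TwistedPolynomial F K) : (Set.range f.coeff).Finite := by
  induction f using induction_on with
  | h0 => exact (Set.finite_singleton 0).subset (by rintro _ ⟨n, rfl⟩; simp)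
  | hm m c =>
    refine (Set.toFinite {c, 0}).subset ?_
    rintro _ ⟨n, rfl⟩
    rw [coeff_monomial]
    split_ifs <;> simp
  | ha f g hf hg =>
    refine (hf.image2 (· + ·) hg).subset ?_
    rintro _ ⟨n, rfl⟩
    exact ⟨_, ⟨n, rfl⟩, _, ⟨n, rfl⟩, (coeff_add f g n).symm⟩

theorem eval_mem {R : Subalgebra F K} {f : TwistedPolynomial F K} (hf : ∀ k, f.coeff k ∈ R) {x : K}
    (hx : x ∈ R) : f.eval x ∈ R := by
  obtain ⟨N, hN⟩ := f.exists_eval_eq_sum_range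
  rw [hN N le_rfl]
  exact sum_mem fun k _ => mul_mem (hf k) (pow_mem hx _)

theorem valuation_eval_le {v : Valuation K ℝ≥0} {f : TwistedPolynomial F K}
    (hf : ∀ k, v (f.coeff k) ≤ 1) {y : K} (hy : v y ≤ 1) :
    v (f.eval y) ≤ v y * max (v (f.coeff 0)) (v y) := by
  obtain ⟨N, hN⟩ := f.exists_eval_eq_sum_range
  rw [hN N le_rfl]
  refine v.map_sum_le fun k _ => ?_
  rw [map_mul, map_pow]
  cases k with
  | zero =>
    rw [pow_zero, pow_one, mul_comm]
    exact mul_le_mul_right (le_max_left _ _) _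
  | succ k =>
    calc v (f.coeff (k + 1)) * v y ^ Fintype.card F ^ (k + 1) ≤ v y ^ 2 :=
          (mul_le_of_le_one_left' (hf _)).trans (pow_le_pow_right_of_le_one' hy
            ((Fintype.one_lt_card (α := F)).trans_le (Nat.le_self_pow (by simp) _)))
      _ ≤ _ := by
          rw [pow_two]
          exact mul_le_mul_right (le_max_right _ _) _

end TwistedPolynomial

/-! ### A uniform lower bound for `|t ^ q ^ k - t|` -/

namespace Valuation

variable (F : Type*) {K : Type*} [Field F] [Fintype F] [Field K] [Algebra F K]

/-- Put `u = t ^ q ^ d - t`. Each step of the induction raises the previous difference to the power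
`q ^ d` and adds `u`; as `|u| < 1`, the term `u` dominates. -/
theorem pow_card_pow_sub_eq {v : Valuation K ℝ≥0} {t : K} {d : ℕ} (hd : d ≠ 0)
    (h : v (t ^ Fintype.card F ^ d - t) < 1) (m : ℕ) :
    v (t ^ Fintype.card F ^ (d * (m + 1)) - t) = v (t ^ Fintype.card F ^ d - t) := by
  obtain h0 | h0 := eq_or_ne (t ^ Fintype.card F ^ d - t) 0
  · have : ∀ m, t ^ Fintype.card F ^ (d * (m + 1)) = t := by
      intro m
      induction m with
      | zero => simpa using sub_eq_zero.mp h0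
      | succ m ih => rw [mul_add, pow_add, pow_mul, ih, mul_one, sub_eq_zero.mp h0]
    rw [this, sub_eq_zero.mp h0]
  induction m with
  | zero => simp
  | succ m ih =>
    have e : t ^ Fintype.card F ^ (d * (m + 1 + 1)) - t =
        (t ^ Fintype.card F ^ (d * (m + 1)) - t) ^ Fintype.card F ^ d +
          (t ^ Fintype.card F ^ d - t) := by
      rw [TwistedPolynomial.pow_card_sub F, ← pow_mul, ← pow_add, ← mul_add_one]
      ring
    rw [e, Valuation.map_add_eq_of_lt_right]
    rw [map_pow, ih]
    exact pow_lt_self_of_lt_one₀ (zero_lt_iff.mpr (v.ne_zero_iff.mpr h0)) h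
      (Nat.one_lt_pow hd (Fintype.one_lt_card (α := F)))

/-- Take `d` minimal and `δ = |t ^ q ^ d - t|`. The value at an exponent divisible by `d` is `δ`; at
any other it is `1`, by minimality applied to the remainder modulo `d`. -/
theorem exists_le_pow_card_pow_sub {v : Valuation K ℝ≥0} {t : K} (ht : v t ≤ 1)
    (ht' : ∀ k, t ^ Fintype.card F ^ (k + 1) ≠ t)
    (h : ∃ d, d ≠ 0 ∧ v (t ^ Fintype.card F ^ d - t) < 1) :
    ∃ δ : ℝ≥0, 0 < δ ∧ δ ≤ 1 ∧ ∀ k, δ ≤ v (t ^ Fintype.card F ^ (k + 1) - t) := by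
  classical
  obtain ⟨hd, hlt⟩ := Nat.find_spec h
  set d := Nat.find h
  have hle (k : ℕ) : v (t ^ Fintype.card F ^ k - t) ≤ 1 :=
    v.map_sub_le (by rw [map_pow]; exact pow_le_one' ht _) ht
  refine ⟨v (t ^ Fintype.card F ^ d - t), ?_, hlt.le, fun k => ?_⟩
  · obtain ⟨e, he⟩ := Nat.exists_eq_succ_of_ne_zero hd
    rw [he, zero_lt_iff, Valuation.ne_zero_iff, sub_ne_zero]
    exact ht' e
  obtain h0 | h0 := Nat.eq_zero_or_pos ((k + 1) % d)
  · obtain ⟨m, hm⟩ := Nat.dvd_of_mod_eq_zero h0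
    cases m with
    | zero => simp at hm
    | succ m => rw [hm, pow_card_pow_sub_eq F hd hlt]
  · have h1 : v (t ^ Fintype.card F ^ ((k + 1) % d) - t) = 1 := by
      refine (hle _).antisymm (le_of_not_gt fun hr => ?_)
      exact Nat.find_min h (Nat.mod_lt (k + 1) (Nat.pos_of_ne_zero hd)) ⟨h0.ne', hr⟩
    have e : t ^ Fintype.card F ^ (k + 1) - t =
        (t ^ Fintype.card F ^ (d * ((k + 1) / d)) - t) ^ Fintype.card F ^ ((k + 1) % d) +
          (t ^ Fintype.card F ^ ((k + 1) % d) - t) := by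
      rw [TwistedPolynomial.pow_card_sub F, ← pow_mul, ← pow_add, Nat.div_add_mod]
      ring
    have h2 : v (t ^ Fintype.card F ^ (d * ((k + 1) / d)) - t) < 1 := by
      cases (k + 1) / d with
      | zero => simp
      | succ m => rwa [pow_card_pow_sub_eq F hd hlt]
    rw [e, Valuation.map_add_eq_of_lt_right, h1]
    · exact hlt.le
    · rw [h1, map_pow]
      exact pow_lt_one' h2 (pow_pos Fintype.card_pos _).ne'

end Valuation

theorem exists_pow_card_pow_sub_mem (F : Type*) {K : Type*} [Field F] [Fintype F] [Field K]
    [Algebra F K] {R : Subalgebra F K} (m : Ideal R) [m.IsPrime] [Finite (R ⧸ m)] (t : R) :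
    ∃ d, d ≠ 0 ∧ t ^ Fintype.card F ^ d - t ∈ m := by
  obtain ⟨i, j, hij, h⟩ := Finite.exists_ne_map_eq_of_infinite
    fun k : ℕ => Ideal.Quotient.mk m (t ^ Fintype.card F ^ k)
  wlog hlt : i < j generalizing i j
  · exact this j i hij.symm h.symm (lt_of_le_of_ne (not_lt.mp hlt) hij.symm)
  refine ⟨j - i, Nat.sub_ne_zero_of_lt hlt, ?_⟩
  -- The pigeonhole principle gives a congruence between two Frobenius iterates; primality allows
  -- the common `q ^ i`-th power to be removed.
  refine Ideal.IsPrime.mem_of_pow_mem ‹_› (Fintype.card F ^ i) ?_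
  have e : (t ^ Fintype.card F ^ (j - i) - t) ^ Fintype.card F ^ i =
      t ^ Fintype.card F ^ j - t ^ Fintype.card F ^ i := by
    apply Subtype.ext
    push_cast
    rw [TwistedPolynomial.pow_card_sub F, ← pow_mul, ← pow_add, Nat.sub_add_cancel hlt.le]
  rw [e]
  exact Ideal.Quotient.eq.mp h.symm

/-! ### The action of `A` and integrality of its coefficients -/

namespace DrinfeldModule

variable {F K : Type*} [Field F] [Fintype F] [Field K] [Algebra F K] [Algebra F[X] K] {g : ℕ}

section Act

variable (φ : Fin g → DrinfeldModule F K)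

theorem act_add (a b : F[X]) (x : Fin g → K) : act φ (a + b) x = act φ a x + act φ b x := by
  ext i
  simp [act]

theorem act_mul (a b : F[X]) (x : Fin g → K) : act φ (a * b) x = act φ a (act φ b x) := by
  ext i
  simp [act, TwistedPolynomial.eval_mul]

theorem act_one (x : Fin g → K) : act φ 1 x = x := by
  ext i
  simp [act]

theorem act_zero_right (a : F[X]) : act φ a (0 : Fin g → K) = 0 := by
  ext i
  simp [act]

/-- The additive map `a ↦ a * x`. -/
def actHom (x : Fin g → K) : F[X] →+ (Fin g → K) :=
  AddMonoidHom.mk' (fun a => act φ a x) fun a b => act_add φ a b x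

theorem isSubmodule_range_actHom (x : Fin g → K) : IsSubmodule φ (actHom φ x).range := by
  rintro a _ ⟨b, rfl⟩
  exact ⟨a * b, act_mul φ a b x⟩

theorem cyclicSubmodule_eq_range (x : Fin g → K) :
    cyclicSubmodule φ x = (actHom φ x).range := by
  refine le_antisymm (sInf_le ⟨isSubmodule_range_actHom φ x, 1, act_one φ x⟩) ?_
  refine le_sInf fun H hH => ?_
  rintro _ ⟨a, rfl⟩
  exact hH.1 a x hH.2

theorem range_actHom_act_le (a : F[X]) (x : Fin g → K) :
    (actHom φ (act φ a x)).range ≤ (actHom φ x).range := by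
  rintro _ ⟨b, rfl⟩
  exact ⟨b * a, act_mul φ b a x⟩

end Act

section Integrality

variable [IsScalarTower F F[X] K] [FaithfulSMul F[X] K] (ψ : DrinfeldModule F K)

omit [Algebra F K] [IsScalarTower F F[X] K] in
theorem algebraMap_X_pow_card_pow_ne (k : ℕ) :
    algebraMap F[X] K Polynomial.X ^ Fintype.card F ^ (k + 1) ≠ algebraMap F[X] K Polynomial.X := by
  rw [← map_pow]
  refine (FaithfulSMul.algebraMap_injective F[X] K).ne fun h => ?_
  have := congrArg Polynomial.natDegree h
  rw [Polynomial.natDegree_X_pow, Polynomial.natDegree_X] at this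
  exact (Nat.one_lt_pow (Nat.succ_ne_zero k) (Fintype.one_lt_card (α := F))).ne' this

omit [IsScalarTower F F[X] K] [FaithfulSMul F[X] K] in
theorem commute_toRingHom (a b : F[X]) : Commute (ψ.toRingHom a) (ψ.toRingHom b) :=
  (Commute.all a b).map ψ.toRingHom

/-- `F`-linearity is not part of the definition. It follows because both sides commute with `φ_t`
and have the same constant coefficient. -/
theorem toRingHom_C (c : F) :
    ψ.toRingHom (Polynomial.C c) = TwistedPolynomial.const F (algebraMap F K c) := by
  refine TwistedPolynomial.eq_of_commute (ψ.commute_toRingHom _ Polynomial.X)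
    (TwistedPolynomial.commute_const c _) (fun k => ?_) ?_
  · rw [ψ.coeff_zero]
    exact algebraMap_X_pow_card_pow_ne k
  · rw [ψ.coeff_zero, TwistedPolynomial.const_eq_monomial, TwistedPolynomial.coeff_monomial,
      if_pos rfl, IsScalarTower.algebraMap_apply F F[X] K, Polynomial.algebraMap_eq]

theorem coeff_toRingHom_mem {R : Subalgebra F K}
    (h : ∀ k, (ψ.toRingHom Polynomial.X).coeff k ∈ R) (a : F[X]) (k : ℕ) :
    (ψ.toRingHom a).coeff k ∈ R := by
  have hmul (a b : F[X]) (ha : ∀ k, (ψ.toRingHom a).coeff k ∈ R)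
      (hb : ∀ k, (ψ.toRingHom b).coeff k ∈ R) (k : ℕ) : (ψ.toRingHom (a * b)).coeff k ∈ R := by
    rw [map_mul, TwistedPolynomial.coeff_mul]
    exact sum_mem fun p _ => mul_mem (ha _) (pow_mem (hb _) _)
  have hC (c : F) (k : ℕ) : (ψ.toRingHom (Polynomial.C c)).coeff k ∈ R := by
    rw [toRingHom_C, TwistedPolynomial.const_eq_monomial, TwistedPolynomial.coeff_monomial]
    split_ifs
    · exact R.algebraMap_mem c
    · exact R.zero_mem
  induction a using Polynomial.induction_on generalizing k with
  | C c => exact hC c k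
  | add p q hp hq =>
    rw [map_add, TwistedPolynomial.coeff_add]
    exact R.add_mem (hp k) (hq k)
  | monomial n c ih =>
    rw [pow_succ, ← mul_assoc]
    exact hmul _ _ ih h k

end Integrality

/-! ### Analytic interpolation of orbits -/

section Analytic

variable [FaithfulSMul F[X] K]
  {φ : Fin g → DrinfeldModule F K} {v : Valuation K ℝ≥0} {δ : ℝ≥0}

/-- The partial sums of the power series that interpolates `a ↦ zᵢ + φᵢ(a)(yᵢ)`. -/
def partialSum (φ : Fin g → DrinfeldModule F K) (y z : Fin g → K) (i : Fin g) (n : ℕ) : K[X] :=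
  Polynomial.C (z i) + ∑ k ∈ Finset.range n, Polynomial.C (y i ^ Fintype.card F ^ k) *
    TwistedPolynomial.coeffPoly F ((φ i).toRingHom Polynomial.X).coeff k

/-- For fixed `a` the series is finite, since `φ_a` has finitely many nonzero coefficients. -/
theorem eventually_eval_partialSum (y z : Fin g → K) (a : F[X]) (i : Fin g) :
    ∀ᶠ n in atTop, (partialSum φ y z i n).eval (algebraMap F[X] K a) = (z + act φ a y) i := by
  obtain ⟨N, hN⟩ := ((φ i).toRingHom a).exists_eval_eq_sum_range
  filter_upwards [eventually_ge_atTop N] with n hn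
  rw [Pi.add_apply, act, hN n hn, partialSum, Polynomial.eval_add, Polynomial.eval_C,
    Polynomial.eval_finsetSum]
  congr 1
  refine Finset.sum_congr rfl fun k _ => ?_
  rw [Polynomial.eval_mul, Polynomial.eval_C, ← (φ i).coeff_zero a,
    TwistedPolynomial.eval_coeffPoly ((φ i).commute_toRingHom a _) (fun k => ?_), mul_comm]
  rw [(φ i).coeff_zero]
  exact algebraMap_X_pow_card_pow_ne k

omit [FaithfulSMul F[X] K] in
-- The term of index `k` has Gauss norm at most `(|y i| / δ) ^ q ^ k`, which tends to `0`.
theorem partialSum_mem (hφ : ∀ i k, v (((φ i).toRingHom Polynomial.X).coeff k) ≤ 1)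
    (h0 : 0 < δ) (h1 : δ ≤ 1)
    (hδ : ∀ k, δ ≤ v (algebraMap F[X] K Polynomial.X ^ Fintype.card F ^ (k + 1) -
      algebraMap F[X] K Polynomial.X))
    {y : Fin g → K} (hy : ∀ i, v (y i) < δ) (z : Fin g → K) (i : Fin g) :
    partialSum φ y z i ∈ gaussCauchySubalgebra v := by
  have hlt : v (y i) * δ⁻¹ < 1 := by
    rw [← div_eq_mul_inv]
    exact (div_lt_one h0).mpr (hy i)
  have hterm (k : ℕ) : GaussLE v (Polynomial.C (y i ^ Fintype.card F ^ k) *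
      TwistedPolynomial.coeffPoly F ((φ i).toRingHom Polynomial.X).coeff k)
      ((v (y i) * δ⁻¹) ^ Fintype.card F ^ k) := by
    rw [mul_pow]
    refine ((GaussLE.C (map_pow v _ _).le).mul (TwistedPolynomial.gaussLE_coeffPoly (hφ i) h0 h1
      (fun k => ?_) k)).mono ?_
    · rw [(φ i).coeff_zero]
      exact hδ k
    · gcongr
      · exact (one_le_inv₀ h0).mpr h1
      · exact Nat.sub_le _ _
  refine ⟨fun ε hε => ?_, max (v (z i)) 1, fun n => ?_⟩
  · have hq : Tendsto (fun k => Fintype.card F ^ k) atTop atTop :=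
      tendsto_pow_atTop_atTop_of_one_lt Fintype.one_lt_card
    have := ((NNReal.tendsto_pow_atTop_nhds_zero_of_lt_one hlt).comp hq).eventually
      (Iic_mem_nhds hε)
    filter_upwards [this] with n hn
    have e : partialSum φ y z i (n + 1) - partialSum φ y z i n =
        Polynomial.C (y i ^ Fintype.card F ^ n) *
          TwistedPolynomial.coeffPoly F ((φ i).toRingHom Polynomial.X).coeff n := by
      rw [partialSum, partialSum, Finset.sum_range_succ]
      ring
    rw [e]
    exact (hterm n).mono hn
  · refine (GaussLE.C (le_max_left _ _)).add ((GaussLE.sum _ fun k _ => ?_).mono (le_max_right _ _))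
    exact (hterm k).mono (pow_le_one' hlt.le _)

/-- The zeros of a polynomial on the coset `z + A * y` form all of it or come from finitely many
elements of `A`, if `y` is close to `0`. -/
theorem forall_eval_eq_zero_or_finite
    (hφ : ∀ i k, v (((φ i).toRingHom Polynomial.X).coeff k) ≤ 1)
    (hA : ∀ a, v (algebraMap F[X] K a) ≤ 1)
    (h0 : 0 < δ) (h1 : δ ≤ 1)
    (hδ : ∀ k, δ ≤ v (algebraMap F[X] K Polynomial.X ^ Fintype.card F ^ (k + 1) -
      algebraMap F[X] K Polynomial.X))
    {y : Fin g → K} (hy : ∀ i, v (y i) < δ) (z : Fin g → K) (P : MvPolynomial (Fin g) K) :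
    (∀ a, MvPolynomial.aeval (z + act φ a y) P = 0) ∨
      {a | MvPolynomial.aeval (z + act φ a y) P = 0}.Finite := by
  refine or_iff_not_imp_right.mpr fun hinf => ?_
  let H : ℕ → K[X] := fun n => MvPolynomial.aeval (fun i => partialSum φ y z i n) P
  have hH : H ∈ gaussCauchySubalgebra v := by
    have e : H = MvPolynomial.aeval (partialSum φ y z) P := by
      ext1 n
      exact (MvPolynomial.comp_aeval_apply (partialSum φ y z)
        (Pi.evalAlgHom K (fun _ : ℕ => K[X]) n) P).symm
    have hle : Algebra.adjoin K (Set.range (partialSum φ y z)) ≤ gaussCauchySubalgebra v := by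
      refine Algebra.adjoin_le ?_
      rintro _ ⟨i, rfl⟩
      exact partialSum_mem hφ h0 h1 hδ hy z i
    rw [e]
    refine hle ?_
    rw [Algebra.adjoin_range_eq_range_aeval]
    exact ⟨P, rfl⟩
  have heval (a : F[X]) : ∀ᶠ n in atTop, (H n).eval (algebraMap F[X] K a) =
      MvPolynomial.aeval (z + act φ a y) P := by
    filter_upwards [eventually_all.mpr (eventually_eval_partialSum (φ := φ) y z a)] with n hn
    rw [← Polynomial.coe_aeval_eq_eval, MvPolynomial.comp_aeval_apply]
    congr 2
    ext i
    rw [← hn i, Polynomial.coe_aeval_eq_eval]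
  -- At each `a ∈ A` the sequence `H` is eventually constant, so zeros of `P` on the coset are
  -- points where `H` tends to `0`, and Strassmann's theorem applies.
  have hsmall (ε : ℝ≥0) (hε : 0 < ε) := hH.1.eventually_gaussLE
    (((Set.Infinite.image (FaithfulSMul.algebraMap_injective F[X] K).injOn hinf)).mono (by
      rintro _ ⟨a, ha, rfl⟩
      refine ⟨hA a, tendsto_const_nhds.congr' ?_⟩
      filter_upwards [heval a] with n hn
      rw [hn, ha, map_zero])) hε
  intro a
  rw [← v.zero_iff, ← nonpos_iff_eq_zero]
  refine le_of_forall_pos_le_add fun ε hε => ?_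
  obtain ⟨n, hn, hn'⟩ := ((hsmall ε hε).and (heval a)).exists
  rw [zero_add, ← hn']
  exact hn.eval (hA a)

end Analytic

end DrinfeldModule

namespace DrinfeldModule

variable {F K : Type*} [Field F] [Fintype F] [Field K] [Algebra F K] [Algebra F[X] K] {g : ℕ}

/-! ### Moving a point into the disc of convergence -/

section SmallMultiple

variable [IsScalarTower F F[X] K] [FaithfulSMul F[X] K]

/-- Pigeonhole principle: `F[X]` is infinite and `(R ⧸ m) ^ g` is finite. -/
theorem exists_act_mem {φ : Fin g → DrinfeldModule F K} {R : Subalgebra F K} {m : Ideal R}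
    [Finite (R ⧸ m)] (hφ : ∀ i k, ((φ i).toRingHom Polynomial.X).coeff k ∈ R)
    {x : Fin g → K} (hx : ∀ i, x i ∈ R) :
    ∃ a : F[X], a ≠ 0 ∧ ∀ i, ∃ y ∈ m, (y : K) = act φ a x i := by
  have hmem (a : F[X]) (i : Fin g) : act φ a x i ∈ R :=
    TwistedPolynomial.eval_mem ((φ i).coeff_toRingHom_mem (hφ i) a) (hx i)
  obtain ⟨a, b, hab, h⟩ := Finite.exists_ne_map_eq_of_infinite
    fun (a : F[X]) (i : Fin g) => Ideal.Quotient.mk m ⟨act φ a x i, hmem a i⟩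
  refine ⟨a - b, sub_ne_zero.mpr hab, fun i => ⟨_, Ideal.Quotient.eq.mp (congrFun h i), ?_⟩⟩
  exact (congrFun (map_sub (actHom φ x) a b) i).symm

/-- On the open unit disc `φ_s` contracts by at least the factor `θ`: its linear coefficient is `s`,
and its other terms are at most `|y| ^ 2`. -/
theorem tendsto_act_pow {φ : Fin g → DrinfeldModule F K} {v : Valuation K ℝ≥0}
    (hφ : ∀ i k, v (((φ i).toRingHom Polynomial.X).coeff k) ≤ 1) {s : F[X]}
    (hs : v (algebraMap F[X] K s) < 1) {y : Fin g → K} (i : Fin g) (hy : v (y i) < 1) :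
    Tendsto (fun n => v (act φ (s ^ n) y i)) atTop (𝓝 0) := by
  have hcoeff (k : ℕ) : v (((φ i).toRingHom s).coeff k) ≤ 1 :=
    (φ i).coeff_toRingHom_mem (R := v.integerSubalgebra F) (hφ i) s k
  set θ := max (v (algebraMap F[X] K s)) (v (y i)) with hθ
  have hθ1 : θ < 1 := max_lt hs hy
  have hbound (n : ℕ) : v (act φ (s ^ n) y i) ≤ v (y i) * θ ^ n := by
    induction n with
    | zero => simp [act_one]
    | succ n ih =>
      have hle : v (act φ (s ^ n) y i) ≤ v (y i) :=
        ih.trans (mul_le_of_le_one_right' (pow_le_one' hθ1.le n))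
      rw [pow_succ', act_mul]
      refine (TwistedPolynomial.valuation_eval_le hcoeff (hle.trans hy.le)).trans ?_
      rw [pow_succ, ← mul_assoc, (φ i).coeff_zero]
      exact mul_le_mul' ih (max_le_max le_rfl hle)
  refine tendsto_of_tendsto_of_tendsto_of_le_of_le tendsto_const_nhds ?_ (fun _ => zero_le) hbound
  simpa using (NNReal.tendsto_pow_atTop_nhds_zero_of_lt_one hθ1).const_mul (v (y i))

/-- For a suitable nonzero `M`, the zeros of a polynomial on each coset of `A * (M * x)` form all of
it or come from finitely many elements of `A`. -/
theorem exists_forall_eval_eq_zero_or_finite [Algebra.IsAlgebraic F[X] K]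
    (φ : Fin g → DrinfeldModule F K) (x : Fin g → K) :
    ∃ M : F[X], M ≠ 0 ∧ ∀ (z : Fin g → K) (P : MvPolynomial (Fin g) K),
      (∀ a, MvPolynomial.aeval (z + act φ a (act φ M x)) P = 0) ∨
        {a | MvPolynomial.aeval (z + act φ a (act φ M x)) P = 0}.Finite := by
  obtain ⟨R, m, v, hS, hm, hfin, hR1, hm1⟩ := exists_valuation_dominating (F := F) (K := K)
    (insert (algebraMap F[X] K Polynomial.X)
      (Set.range x ∪ ⋃ i, Set.range ((φ i).toRingHom Polynomial.X).coeff))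
    (((Set.finite_range x).union (Set.finite_iUnion fun i =>
      TwistedPolynomial.finite_range_coeff _)).insert _)
  have hX : algebraMap F[X] K Polynomial.X ∈ R := hS (Set.mem_insert _ _)
  have hx (i : Fin g) : x i ∈ R := hS (Or.inr (Or.inl ⟨i, rfl⟩))
  have hφ (i : Fin g) (k : ℕ) : ((φ i).toRingHom Polynomial.X).coeff k ∈ R :=
    hS (Or.inr (Or.inr (Set.mem_iUnion.mpr ⟨i, k, rfl⟩)))
  have hφ1 (i : Fin g) (k : ℕ) : v (((φ i).toRingHom Polynomial.X).coeff k) ≤ 1 := hR1 _ (hφ i k)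
  have hA (a : F[X]) : v (algebraMap F[X] K a) ≤ 1 := by
    have : algebraMap F[X] K a = Polynomial.aeval (algebraMap F[X] K Polynomial.X) a := by
      rw [Polynomial.aeval_algebraMap_apply, Polynomial.aeval_X_left_apply]
    rw [this]
    exact v.aeval_le_one_of_finite (hR1 _ hX) a
  obtain ⟨d, hd, hdm⟩ := exists_pow_card_pow_sub_mem F m ⟨_, hX⟩
  have hd1 : v (algebraMap F[X] K Polynomial.X ^ Fintype.card F ^ d -
      algebraMap F[X] K Polynomial.X) < 1 := hm1 _ hdm
  obtain ⟨δ, h0, h1, hδ⟩ := Valuation.exists_le_pow_card_pow_sub F (hR1 _ hX)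
    algebraMap_X_pow_card_pow_ne ⟨d, hd, hd1⟩
  obtain ⟨Q, hQ, hQm⟩ := exists_act_mem (m := m) hφ hx
  have hQ1 (i : Fin g) : v (act φ Q x i) < 1 := by
    obtain ⟨y, hy, e⟩ := hQm i
    exact e ▸ hm1 y hy
  set s : F[X] := Polynomial.X ^ Fintype.card F ^ d - Polynomial.X with hs_def
  have hs : algebraMap F[X] K s = algebraMap F[X] K Polynomial.X ^ Fintype.card F ^ d -
      algebraMap F[X] K Polynomial.X := by
    rw [hs_def, map_sub, map_pow]
  have hs0 : s ≠ 0 := by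
    obtain ⟨e, rfl⟩ := Nat.exists_eq_succ_of_ne_zero hd
    intro h
    rw [h, map_zero, eq_comm, sub_eq_zero] at hs
    exact algebraMap_X_pow_card_pow_ne e hs
  -- `Q` brings `x` into the open unit disc; powers of `s`, which has `|s| < 1`, then shrink it
  -- below the radius `δ`.
  obtain ⟨n, hn⟩ := (eventually_all.mpr fun i => (tendsto_act_pow hφ1 (s := s) (by rwa [hs]) i
    (hQ1 i)).eventually (Iio_mem_nhds h0)).exists
  refine ⟨s ^ n * Q, mul_ne_zero (pow_ne_zero n hs0) hQ, fun z P => ?_⟩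
  refine forall_eval_eq_zero_or_finite hφ1 hA h0 h1 hδ (fun i => ?_) z P
  rw [act_mul]
  exact hn i

end SmallMultiple

/-! ### Finite unions of cosets -/

section Cosets

variable (φ : Fin g → DrinfeldModule F K) (x : Fin g → K)

/-- `C` is a coset in the cyclic submodule generated by `x` of a submodule. -/
def IsCoset (C : Set (Fin g → K)) : Prop :=
  ∃ γ ∈ cyclicSubmodule φ x, ∃ N : AddSubgroup (Fin g → K),
    IsSubmodule φ N ∧ N ≤ cyclicSubmodule φ x ∧ C = (fun y => γ + y) '' (N : Set (Fin g → K))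

/-- `S` is a finite union of cosets of submodules of the cyclic submodule generated by `x`. -/
def IsFiniteUnionOfCosets (S : Set (Fin g → K)) : Prop :=
  ∃ 𝒞 : Set (Set (Fin g → K)), 𝒞.Finite ∧ (∀ C ∈ 𝒞, IsCoset φ x C) ∧ S = ⋃₀ 𝒞

variable {φ x}

theorem IsCoset.isFiniteUnionOfCosets {C : Set (Fin g → K)} (h : IsCoset φ x C) :
    IsFiniteUnionOfCosets φ x C :=
  ⟨{C}, Set.finite_singleton C, fun _ h' => Set.mem_singleton_iff.mp h' ▸ h, by simp⟩

theorem IsFiniteUnionOfCosets.iUnion {ι : Type*} [Finite ι] {S : ι → Set (Fin g → K)}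
    (h : ∀ i, IsFiniteUnionOfCosets φ x (S i)) : IsFiniteUnionOfCosets φ x (⋃ i, S i) := by
  choose 𝒞 hfin hcoset hS using h
  refine ⟨⋃ i, 𝒞 i, Set.finite_iUnion hfin, fun C hC => ?_, ?_⟩
  · obtain ⟨i, hi⟩ := Set.mem_iUnion.mp hC
    exact hcoset i C hi
  · rw [Set.sUnion_iUnion]
    exact Set.iUnion_congr hS

theorem isCoset_singleton {γ : Fin g → K} (hγ : γ ∈ cyclicSubmodule φ x) : IsCoset φ x {γ} := by
  refine ⟨γ, hγ, ⊥, ?_, bot_le, by simp⟩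
  rintro a y hy
  rw [AddSubgroup.mem_bot] at hy ⊢
  rw [hy, act_zero_right]

theorem isFiniteUnionOfCosets_of_finite {S : Set (Fin g → K)} (hS : S.Finite)
    (h : S ⊆ cyclicSubmodule φ x) : IsFiniteUnionOfCosets φ x S := by
  have := hS.to_subtype
  rw [← Set.iUnion_of_singleton_coe S]
  exact .iUnion fun γ => (isCoset_singleton (h γ.2)).isFiniteUnionOfCosets

theorem IsFiniteUnionOfCosets.exists_fin {S : Set (Fin g → K)}
    (h : IsFiniteUnionOfCosets φ x S) :
    ∃ (n : ℕ) (γ : Fin n → Fin g → K) (N : Fin n → AddSubgroup (Fin g → K)),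
      (∀ j, γ j ∈ cyclicSubmodule φ x ∧ IsSubmodule φ (N j) ∧ N j ≤ cyclicSubmodule φ x) ∧
      S = ⋃ j, (fun y => γ j + y) '' (N j : Set (Fin g → K)) := by
  obtain ⟨𝒞, hfin, hcoset, rfl⟩ := h
  have := hfin.to_subtype
  obtain ⟨n, ⟨e⟩⟩ := Finite.exists_equiv_fin 𝒞
  choose γ hγ N hN hNle hC using fun j => hcoset (e.symm j) (e.symm j).2
  refine ⟨n, γ, N, fun j => ⟨hγ j, hN j, hNle j⟩, ?_⟩
  rw [Set.sUnion_eq_iUnion, ← e.symm.surjective.iUnion_comp]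
  exact Set.iUnion_congr hC

variable [IsScalarTower F F[X] K] [FaithfulSMul F[X] K] [Algebra.IsAlgebraic F[X] K]

theorem isFiniteUnionOfCosets_zeroLocus_inter (φ : Fin g → DrinfeldModule F K) (x : Fin g → K)
    (V : Ideal (MvPolynomial (Fin g) K)) :
    IsFiniteUnionOfCosets φ x
      (MvPolynomial.zeroLocus K V ∩ (cyclicSubmodule φ x : Set (Fin g → K))) := by
  obtain ⟨M, hM, h⟩ := exists_forall_eval_eq_zero_or_finite φ x
  -- Polynomials of degree less than that of `M` represent the classes of `A / M`, hence the cosets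
  -- of `A * (M * x)` in `Γ`.
  have hfin : Finite (Polynomial.degreeLT F M.natDegree) :=
    Finite.of_equiv _ (Polynomial.degreeLTEquiv F M.natDegree).toEquiv.symm
  have hmem (r a : F[X]) : act φ r x + act φ a (act φ M x) ∈ cyclicSubmodule φ x := by
    rw [cyclicSubmodule_eq_range, ← act_mul, ← act_add]
    exact ⟨_, rfl⟩
  have hunion : MvPolynomial.zeroLocus K V ∩ (cyclicSubmodule φ x : Set (Fin g → K)) =
      ⋃ r : Polynomial.degreeLT F M.natDegree, (fun a => act φ r x + act φ a (act φ M x)) ''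
        {a | act φ r x + act φ a (act φ M x) ∈ MvPolynomial.zeroLocus K V} := by
    ext y
    simp only [Set.mem_inter_iff, Set.mem_iUnion, Set.mem_image, Set.mem_ofPred_eq]
    constructor
    · rintro ⟨hy, hyΓ⟩
      rw [cyclicSubmodule_eq_range] at hyΓ
      obtain ⟨a, rfl⟩ := hyΓ
      have e : act φ (a % M) x + act φ (a / M) (act φ M x) = act φ a x := by
        rw [← act_mul, ← act_add, mul_comm, EuclideanDomain.mod_add_div]
      have hr : a % M ∈ Polynomial.degreeLT F M.natDegree := by
        rw [Polynomial.mem_degreeLT, ← Polynomial.degree_eq_natDegree hM]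
        exact Polynomial.degree_mod_lt a hM
      exact ⟨⟨a % M, hr⟩, a / M, by rwa [e], e⟩
    · rintro ⟨r, a, ha, rfl⟩
      exact ⟨ha, hmem r a⟩
  rw [hunion]
  refine .iUnion fun r => ?_
  -- Either every polynomial of the ideal vanishes on the whole coset, or a single one that does not
  -- already leaves only finitely many `a`.
  by_cases hall : ∀ P ∈ V, ∀ a, MvPolynomial.aeval (act φ r x + act φ a (act φ M x)) P = 0
  · refine IsCoset.isFiniteUnionOfCosets ⟨act φ r x, ?_, (actHom φ (act φ M x)).range,
      isSubmodule_range_actHom φ _, ?_, ?_⟩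
    · rw [cyclicSubmodule_eq_range]
      exact ⟨r, rfl⟩
    · rw [cyclicSubmodule_eq_range]
      exact range_actHom_act_le φ M x
    · have huniv : {a | act φ r x + act φ a (act φ M x) ∈ MvPolynomial.zeroLocus K V} =
          Set.univ :=
        Set.eq_univ_of_forall fun a => MvPolynomial.mem_zeroLocus_iff.mpr fun P hP => hall P hP a
      rw [huniv, Set.image_univ, AddMonoidHom.coe_range, ← Set.range_comp]
      rfl
  · simp only [not_forall] at hall
    obtain ⟨P, hP, a, ha⟩ := hall
    refine isFiniteUnionOfCosets_of_finite (Set.Finite.image _ ?_) ?_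
    · refine ((h (act φ r x) P).resolve_left fun h' => ha (h' a)).subset fun b hb => ?_
      exact MvPolynomial.mem_zeroLocus_iff.mp hb P hP
    · rintro _ ⟨b, -, rfl⟩
      exact hmem r b

end Cosets

end DrinfeldModule

end

theorem theorem2p4 {F K : Type*} [Field F] [Fintype F] [Field K]
    [Algebra F K] [Algebra F[X] K] [Algebra (RatFunc F) K]
    [IsScalarTower F F[X] K] [IsScalarTower F[X] (RatFunc F) K]
    -- `K` is a finite extension of `F(t)`
    [FunctionField F K]
    {g : ℕ} (φ : Fin g → DrinfeldModule F K) (x : Fin g → K)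
    -- the closed subvariety `V` of affine `g`-space, given by an ideal of `K[X₁, …, X_g]`
    (V : Ideal (MvPolynomial (Fin g) K)) :
    ∃ (n : ℕ) (γ : Fin n → Fin g → K) (N : Fin n → AddSubgroup (Fin g → K)),
      (∀ j, γ j ∈ DrinfeldModule.cyclicSubmodule φ x ∧
        DrinfeldModule.IsSubmodule φ (N j) ∧ N j ≤ DrinfeldModule.cyclicSubmodule φ x) ∧
      MvPolynomial.zeroLocus K V ∩ (DrinfeldModule.cyclicSubmodule φ x : Set (Fin g → K)) =
        ⋃ j, (fun y => γ j + y) '' (N j : Set (Fin g → K)) := by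
  have : FaithfulSMul F[X] K := FaithfulSMul.trans F[X] (RatFunc F) K
  have : Algebra.IsAlgebraic F[X] K :=
    (IsFractionRing.comap_isAlgebraic_iff (A := F[X]) (K := RatFunc F) (C := K)).mpr
      (Algebra.IsAlgebraic.of_finite (RatFunc F) K)
  exact (DrinfeldModule.isFiniteUnionOfCosets_zeroLocus_inter φ x V).exists_fin
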